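/- Let $r\ge 5$ be odd and let $e_1,\dots,e_r$ be the standard orthonormal basis of $\mathbb R^r$. Let $W(D_r)$ be the group of signed permutations $e_j\mapsto \varepsilon_j e_{\pi(j)}$ ($\pi\in S_r$, $\varepsilon_j\in\{\pm1\}$) with an even number of sign changes. Its positive roots are $\Pi_+=\{e_i-e_j,\ e_i+e_j: 1\le i<j\le r\}$ and its simple roots are $\alpha_i=e_i-e_{i+1}$ ($1\le i\le r-1$) and $\alpha_r=e_{r-1}+e_r$. For positive roots write $\rho\le\eta$ if $\eta-\rho\in\sum_a\mathbb Z_{\ge0}\alpha_a$, and for $S\subseteq\Pi_+$ put $\mathrm{Adj}(S)=\{\gamma\in\Pi_+:\gamma\le\beta\text{ for some }\beta\in S\}$. For $u\in W(D_r)$ let $\nu_0(u)=u(\Pi_+)\cap\Pi_+$ and $\nu_k(u)=u(\mathrm{Adj}(\nu_{k-1}(u)))\cap\Pi_+$ for $k\ge1$; $u$ is called rational if $\nu_k(u)=\varnothing$ for all sufficiently large $k$. Let $\Gamma(D_r)$ be the graph whose vertices are the rational elements of $W(D_r)$, two vertices being adjacent (written $\sim$) when they differ by left multiplication by a simple reflection.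 Let $w_0$ be the longest element: $w_0(e_i)=-e_i$ for $i\le r-1$, and $w_0(e_r)=e_r$. For a non-empty $I=\{i_1<\dots<i_k\}\subseteq\{1,\dots,r-1\}$ let $p_I\in S_r$ be the cycle $i_1\mapsto i_2\mapsto\cdots\mapsto i_k\mapsto r\mapsto i_1$, and define $$c_I(e_j)=-e_{p_I(j)}\ (1\le j\le r-1),\qquad c_I(e_r)=e_{i_1},$$ $$d_I(e_j)=-e_{p_I(j)}\ (1\le j\le r-1,\ j\ne i_k),\qquad d_I(e_{i_k})=e_r,\qquad d_I(e_r)=-e_{i_1}.$$ Put $c_\varnothing=d_\varnothing=w_0$. Then the rational elements of $W(D_r)$ are precisely the elements of $$\mathcal F_r=\{w_0\}\cup\{c_I,d_I:\varnothing\ne I\subseteq\{1,\dots,r-1\}\},$$ and $\#\mathcal F_r=1+2(2^{r-1}-1)=2^r-1$. Moreover, for all $I\subseteq\{1,\dots,r-1\}$ and $1\le a\le r-2$, $$c_I\sim c_{I\triangle\{a\}}\iff a+1\in I,\qquad d_I\sim d_{I\triangle\{a\}}\iff a+1\in I,$$ and $c_I\sim c_{I\triangle\{r-1\}}$, $d_I\sim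 d_{I\triangle\{r-1\}}$ for all $I\subseteq\{1,\dots,r-1\}$. The graph $\Gamma(D_r)$ has no other edges. In particular, $c_{\{1\}}$ and $d_{\{1\}}$ are the only vertices of valency one in $\Gamma(D_r)$. -/

import Mathlib

/-! Rank `r = n + 1`.  The index `i : Fin (n + 1)` stands for the number `i + 1 ∈ {1, …, r}`;
`Fin.last n` stands for `r`, and `Fin n` stands for `{1, …, r - 1}`. -/

namespace TypeD

/-- The space `ℝ ^ r`, `r = n + 1`, with its standard basis and the standard dot product. -/
abbrev V (n : ℕ) : Type := Fin (n + 1) → ℝ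

/-- The standard basis vectors. -/
def e {n : ℕ} (i : Fin (n + 1)) : V n := Pi.single i 1

/-- The signed permutation `e j ↦ ε j • e (π j)` as a linear automorphism of `ℝ ^ r`. -/
def signedPerm {n : ℕ} (π : Equiv.Perm (Fin (n + 1))) (ε : Fin (n + 1) → ℤˣ) :
    V n ≃ₗ[ℝ] V n where
  toFun x i := ((ε (π.symm i) : ℤ) : ℝ) * x (π.symm i)
  invFun x j := ((ε j : ℤ) : ℝ) * x (π j)
  map_add' x y := by ext i; simp [mul_add]
  map_smul' t x := by ext i; simp [mul_left_comm]
  left_inv x := by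
    ext j
    rcases Int.units_eq_one_or (ε j) with h | h <;> simp [h]
  right_inv x := by
    ext i
    rcases Int.units_eq_one_or (ε (π.symm i)) with h | h <;> simp [h]

theorem signedPerm_e {n : ℕ} (π : Equiv.Perm (Fin (n + 1))) (ε : Fin (n + 1) → ℤˣ)
    (j : Fin (n + 1)) : signedPerm π ε (e j) = ((ε j : ℤ) : ℝ) • e (π j) := by
  ext i
  by_cases h : i = π j
  · subst h; simp [signedPerm, e]
  · have h' : π.symm i ≠ j := fun h'' => h (by simp [← h''])
    simp [signedPerm, e, h, h']

theorem even_iff_prod {n : ℕ} (ε : Fin (n + 1) → ℤˣ) :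
    Even (Finset.univ.filter fun j => ε j = -1).card ↔ ∏ j, ε j = 1 := by
  have h : ∏ j, ε j = (-1) ^ (Finset.univ.filter fun j => ε j = -1).card := by
    rw [← Finset.prod_const, Finset.prod_filter]
    refine Finset.prod_congr rfl fun j _ => ?_
    rcases Int.units_eq_one_or (ε j) with h | h <;> simp [h]
  rw [h]
  rcases Nat.even_or_odd (Finset.univ.filter fun j => ε j = -1).card with h' | h'
  · simp [h', h'.neg_one_pow]
  · simp [Nat.not_even_iff_odd.mpr h', h'.neg_one_pow]

/-- The Weyl group `W(D_r)`: signed permutations with an even number of sign changes. -/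
def W (n : ℕ) : Subgroup (V n ≃ₗ[ℝ] V n) where
  carrier := {u | ∃ (π : Equiv.Perm (Fin (n + 1))) (ε : Fin (n + 1) → ℤˣ),
    Even (Finset.univ.filter fun j => ε j = -1).card ∧ u = signedPerm π ε}
  one_mem' := ⟨1, 1, by simp, by apply LinearEquiv.ext; intro x; ext i; simp [signedPerm]; rfl⟩
  mul_mem' := by
    rintro _ _ ⟨π, ε, h, rfl⟩ ⟨π', ε', h', rfl⟩
    refine ⟨π * π', fun j => ε (π' j) * ε' j, ?_, ?_⟩
    · rw [even_iff_prod] at *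
      rw [Finset.prod_mul_distrib, h', Equiv.prod_comp π' ε, h, one_mul]
    · apply LinearEquiv.ext
      intro x
      ext i
      simp [signedPerm, mul_assoc]
      simp [Equiv.Perm.mul_def]
  inv_mem' := by
    rintro _ ⟨π, ε, h, rfl⟩
    refine ⟨π⁻¹, fun j => ε (π⁻¹ j), ?_, ?_⟩
    · rw [even_iff_prod] at *
      rw [Equiv.prod_comp π⁻¹ ε, h]
    · apply LinearEquiv.ext
      intro x
      rw [LinearEquiv.coe_inv, LinearEquiv.symm_apply_eq]
      ext i
      rcases Int.units_eq_one_or (ε (π.symm i)) with h | h <;>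
        simp [signedPerm, h, Equiv.Perm.inv_def]

/-- The positive roots `e_i - e_j` and `e_i + e_j`, `i < j`. -/
def posRoots (n : ℕ) : Set (V n) :=
  {x | ∃ i j : Fin (n + 1), i < j ∧ x = e i - e j} ∪
    {x | ∃ i j : Fin (n + 1), i < j ∧ x = e i + e j}

/-- The simple roots `e_i - e_{i+1}` for `1 ≤ i ≤ r - 1`, and `e_{r-1} + e_r`. -/
def simpleRoots (n : ℕ) : Set (V n) :=
  {x | ∃ i : Fin n, x = e i.castSucc - e i.succ} ∪
    {x | ∃ i : Fin n, i.succ = Fin.last n ∧ x = e i.castSucc + e i.succ}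

/-- The root order: `η - ρ` is a sum of simple roots with coefficients in `ℕ`. -/
def RootLE {n : ℕ} (ρ η : V n) : Prop := η - ρ ∈ AddSubmonoid.closure (simpleRoots n)

/-- The positive roots below some element of `S`. -/
def adj {n : ℕ} (S : Set (V n)) : Set (V n) :=
  {γ | γ ∈ posRoots n ∧ ∃ β ∈ S, RootLE γ β}

/-- The descending sequence `ν_k(u)`. -/
def nu {n : ℕ} (u : V n ≃ₗ[ℝ] V n) : ℕ → Set (V n)
  | 0 => u '' posRoots n ∩ posRoots n
  | k + 1 => u '' adj (nu u k) ∩ posRoots n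

/-- `u` is a rational element of the Weyl group `W(D_r)`. -/
def IsRational {n : ℕ} (u : V n ≃ₗ[ℝ] V n) : Prop :=
  u ∈ W n ∧ ∃ N : ℕ, ∀ k ≥ N, nu u k = ∅

/-- The orthogonal reflection in the hyperplane perpendicular to `α`. -/
noncomputable def reflect {n : ℕ} (α x : V n) : V n := x - (2 * (x ⬝ᵥ α) / (α ⬝ᵥ α)) • α

/-- The graph `Γ(D_r)`: its vertices are the rational elements of `W(D_r)`, and two distinct
vertices are adjacent when one is `s_α` times the other, for a simple root `α`. -/
def rationalityGraph (n : ℕ) : SimpleGraph {u : V n ≃ₗ[ℝ] V n // IsRational u} :=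
  SimpleGraph.fromRel fun u v => ∃ α ∈ simpleRoots n, ∀ x, v.1 x = reflect α (u.1 x)

/-- `w_0`: `e_j ↦ -e_j` for `j < r`, and `e_r ↦ e_r`. -/
def w0 (n : ℕ) : V n ≃ₗ[ℝ] V n :=
  signedPerm 1 fun j => if j = Fin.last n then 1 else -1

/-- The cycle `p_I = (i_1 i_2 ⋯ i_k r)` for `I = {i_1 < ⋯ < i_k} ⊆ {1, …, r - 1}`. -/
def p {n : ℕ} (I : Finset (Fin n)) : Equiv.Perm (Fin (n + 1)) :=
  ((I.sort (· ≤ ·)).map Fin.castSucc ++ [Fin.last n]).formPerm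

/-- For non-empty `I`: `c_I(e_j) = -e_{p_I(j)}` for `j < r`, and `c_I(e_r) = e_{i_1}`
(here `i_1 = p_I(r)`).  By convention `c_∅ = w_0`. -/
def c {n : ℕ} (I : Finset (Fin n)) : V n ≃ₗ[ℝ] V n :=
  if I.Nonempty then signedPerm (p I) fun j => if j = Fin.last n then 1 else -1
  else w0 n

/-- For non-empty `I` with maximum `i_k`: `d_I(e_j) = -e_{p_I(j)}` for `j ≠ i_k`
(so `d_I(e_r) = -e_{i_1}`), and `d_I(e_{i_k}) = e_r`.  By convention `d_∅ = w_0`. -/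
def d {n : ℕ} (I : Finset (Fin n)) : V n ≃ₗ[ℝ] V n :=
  if h : I.Nonempty then signedPerm (p I) fun j => if j = (I.max' h).castSucc then 1 else -1
  else w0 n

end TypeD

/-!
If a non-empty set `S` of positive roots satisfies `S ⊆ u(Adj S)`, then `S ⊆ ν_k(u)` for all `k`,
and `u` is not rational. One- and two-element sets `S` show in this way that the permutation `π`
underlying a rational `u` satisfies `j ≤ π j` for all `j < r`, and that `u e_j = e_k` with `j < r`
forces `k = r`. A permutation with the first property is `p_I` for `I` the set of indices `j < r`
it moves, and the parity of the number of sign changes then leaves only `c_I` and `d_I`.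

Conversely, by monotonicity of the coordinate sum, `Adj(ν_k(c_I))` contains only roots `e_i - e_j`,
and those that `c_I` maps to positive roots have `i < j < p_I(i)`. Since `p_I` fixes every such `j`,
no root survives a second step, so `ν_2(c_I) = ∅`. The diagram automorphism `e_r ↦ -e_r` exchanges
`c_I` and `d_I`.

For the edges, `s_a c_I` has underlying permutation `(a a+1) p_I`, which again has the raising
property iff `a + 1 ∈ I ∪ {r}`, and then equals `p_{I ∆ {a}}`; the reflection in `e_{r-1} + e_r`
keeps `c_I` rational only for `I = ∅`, where `c_∅ = d_∅`.
-/

namespace TypeD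

variable {n : ℕ} {π : Equiv.Perm (Fin (n + 1))} {ε : Fin (n + 1) → ℤˣ} {u v : V n ≃ₗ[ℝ] V n}

/-! ### Signed permutations -/

theorem signedPerm_apply (π : Equiv.Perm (Fin (n + 1))) (ε : Fin (n + 1) → ℤˣ) (x : V n)
    (i : Fin (n + 1)) :
    signedPerm π ε x i = ((ε (π.symm i) : ℤ) : ℝ) * x (π.symm i) := rfl

theorem signedPerm_e_eq_units_smul (π : Equiv.Perm (Fin (n + 1))) (ε : Fin (n + 1) → ℤˣ)
    (j : Fin (n + 1)) : signedPerm π ε (e j) = ε j • e (π j) := by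
  rw [signedPerm_e, Units.smul_def, Int.cast_smul_eq_zsmul]

theorem signedPerm_units_smul_e (π : Equiv.Perm (Fin (n + 1))) (ε : Fin (n + 1) → ℤˣ)
    (s : ℤˣ) (j : Fin (n + 1)) : signedPerm π ε (s • e j) = (s * ε j) • e (π j) := by
  rw [Units.smul_def, map_zsmul, signedPerm_e_eq_units_smul, mul_smul, Units.smul_def s]

theorem signedPerm_e_add_units_smul_e (π : Equiv.Perm (Fin (n + 1))) (ε : Fin (n + 1) → ℤˣ)
    (i j : Fin (n + 1)) (s : ℤˣ) :
    signedPerm π ε (e i + s • e j) = ε i • e (π i) + (s * ε j) • e (π j) := by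
  rw [map_add, signedPerm_e_eq_units_smul, signedPerm_units_smul_e]

theorem signedPerm_mul_signedPerm (π π' : Equiv.Perm (Fin (n + 1))) (ε ε' : Fin (n + 1) → ℤˣ) :
    signedPerm π ε * signedPerm π' ε' = signedPerm (π * π') fun j => ε (π' j) * ε' j := by
  ext x i
  simp [signedPerm_apply, mul_assoc, Equiv.Perm.mul_def]

theorem units_smul_e_inj {s t : ℤˣ} {i j : Fin (n + 1)} :
    s • e i = t • e j ↔ s = t ∧ i = j := by
  refine ⟨fun h => ?_, fun ⟨hs, hi⟩ => by rw [hs, hi]⟩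
  have hi := congrFun h i
  by_cases hij : i = j
  · subst hij
    exact ⟨Units.ext (by simpa [e, Units.smul_def] using hi), rfl⟩
  · simp [e, Units.smul_def, hij] at hi

theorem signedPerm_inj {π π' : Equiv.Perm (Fin (n + 1))} {ε ε' : Fin (n + 1) → ℤˣ} :
    signedPerm π ε = signedPerm π' ε' ↔ π = π' ∧ ε = ε' := by
  refine ⟨fun h => ?_, fun ⟨hπ, hε⟩ => by rw [hπ, hε]⟩
  have key (j) : ε j = ε' j ∧ π j = π' j := by
    rw [← units_smul_e_inj, ← signedPerm_e_eq_units_smul, h, signedPerm_e_eq_units_smul]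
  exact ⟨Equiv.ext fun j => (key j).2, funext fun j => (key j).1⟩

theorem signedPerm_dotProduct_signedPerm (π : Equiv.Perm (Fin (n + 1)))
    (ε : Fin (n + 1) → ℤˣ) (x y : V n) : signedPerm π ε x ⬝ᵥ signedPerm π ε y = x ⬝ᵥ y := by
  rw [dotProduct, dotProduct, ← Equiv.sum_comp π]
  refine Finset.sum_congr rfl fun i _ => ?_
  rcases Int.units_eq_one_or (ε i) with h | h <;> simp [signedPerm_apply, h]

/-! ### The root order -/

theorem mem_posRoots_iff {x : V n} :
    x ∈ posRoots n ↔ ∃ i j, i < j ∧ ∃ s : ℤˣ, x = e i + s • e j := by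
  constructor
  · rintro (⟨i, j, h, rfl⟩ | ⟨i, j, h, rfl⟩)
    · exact ⟨i, j, h, -1, by simp [sub_eq_add_neg]⟩
    · exact ⟨i, j, h, 1, by simp⟩
  · rintro ⟨i, j, h, s, rfl⟩
    rcases Int.units_eq_one_or s with rfl | rfl
    · exact Or.inr ⟨i, j, h, by simp⟩
    · exact Or.inl ⟨i, j, h, by simp [sub_eq_add_neg]⟩

theorem e_add_units_smul_e_mem_posRoots {i j : Fin (n + 1)} (h : i < j) (s : ℤˣ) :
    e i + s • e j ∈ posRoots n :=
  mem_posRoots_iff.mpr ⟨i, j, h, s, rfl⟩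

theorem e_sub_e_mem_posRoots {i j : Fin (n + 1)} (h : i < j) : e i - e j ∈ posRoots n :=
  Or.inl ⟨i, j, h, rfl⟩

theorem e_add_e_mem_posRoots {i j : Fin (n + 1)} (h : i ≠ j) : e i + e j ∈ posRoots n := by
  rcases h.lt_or_gt with h | h
  · exact Or.inr ⟨i, j, h, rfl⟩
  · exact Or.inr ⟨j, i, h, add_comm _ _⟩

theorem simpleRoots_subset_posRoots : simpleRoots n ⊆ posRoots n := by
  rintro x (⟨i, rfl⟩ | ⟨i, -, rfl⟩)
  · exact e_sub_e_mem_posRoots i.castSucc_lt_succ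
  · exact e_add_e_mem_posRoots i.castSucc_lt_succ.ne

theorem RootLE.refl (x : V n) : RootLE x x := by simp [RootLE]

theorem RootLE.add {x y x' y' : V n} (h : RootLE x y) (h' : RootLE x' y') :
    RootLE (x + x') (y + y') := by
  rw [RootLE, add_sub_add_comm]
  exact add_mem h h'

theorem RootLE.trans {x y z : V n} (h : RootLE x y) (h' : RootLE y z) : RootLE x z := by
  simpa [RootLE] using add_mem h' h

theorem RootLE.neg {x y : V n} (h : RootLE x y) : RootLE (-y) (-x) := by
  rwa [RootLE, neg_sub_neg]

theorem rootLE_e {i j : Fin (n + 1)} (h : i ≤ j) : RootLE (e j) (e i) := by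
  induction j using Fin.induction with
  | zero => rw [Fin.le_zero_iff.mp h]; exact .refl _
  | succ j ih =>
    rcases h.eq_or_lt with rfl | h
    · exact .refl _
    · exact .trans (AddSubmonoid.subset_closure (Or.inl ⟨j, rfl⟩)) (ih (Fin.le_castSucc_iff.mpr h))

theorem rootLE_neg_e_last {i : Fin (n + 1)} (h : i ≠ Fin.last n) :
    RootLE (-e (Fin.last n)) (e i) := by
  obtain ⟨i, rfl⟩ := Fin.exists_castSucc_eq.mpr h
  obtain ⟨m, rfl⟩ : ∃ m, n = m + 1 := Nat.exists_eq_add_one.mpr i.pos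
  have hs : RootLE (-e (Fin.last (m + 1))) (e (Fin.last m).castSucc) :=
    AddSubmonoid.subset_closure (Or.inr ⟨Fin.last m, rfl, by rw [sub_neg_eq_add]; rfl⟩)
  exact hs.trans (rootLE_e (Fin.castSucc_le_castSucc_iff.mpr (Fin.le_last i)))

theorem rootLE_units_smul_e {i j : Fin (n + 1)} (h : i ≤ j) (hi : i ≠ Fin.last n) (s : ℤˣ) :
    RootLE (s • e j) (e i) := by
  rcases Int.units_eq_one_or s with rfl | rfl
  · simpa using rootLE_e h
  · simpa using (rootLE_e (Fin.le_last j)).neg.trans (rootLE_neg_e_last hi)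

/-- The sum of the coordinates up to `t`, a functional that is monotone for the root order. -/
def partialSum (t : Fin (n + 1)) : V n →ₗ[ℝ] ℝ := ∑ i ∈ Finset.Iic t, LinearMap.proj i

theorem partialSum_e (t i : Fin (n + 1)) : partialSum t (e i) = if i ≤ t then 1 else 0 := by
  simp [partialSum, e, Pi.single_apply]

theorem partialSum_last_units_smul_e (s : ℤˣ) (i : Fin (n + 1)) :
    partialSum (Fin.last n) (s • e i) = ((s : ℤ) : ℝ) := by
  rw [Units.smul_def, map_zsmul, partialSum_e, if_pos (Fin.le_last i), zsmul_one]

theorem partialSum_nonneg_of_mem_posRoots {x : V n} (hx : x ∈ posRoots n) (t : Fin (n + 1)) :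
    0 ≤ partialSum t x := by
  rcases hx with ⟨i, j, h, rfl⟩ | ⟨i, j, -, rfl⟩
  · rw [map_sub, sub_nonneg, partialSum_e, partialSum_e]
    split_ifs with hj hi <;> first | exact absurd (h.le.trans hj) hi | norm_num
  · rw [map_add, partialSum_e, partialSum_e]
    positivity

theorem RootLE.partialSum_le {x y : V n} (h : RootLE x y) (t : Fin (n + 1)) :
    partialSum t x ≤ partialSum t y := by
  have hle : AddSubmonoid.closure (simpleRoots n) ≤
      (AddSubmonoid.nonneg ℝ).comap (partialSum t) :=
    AddSubmonoid.closure_le.mpr fun α hα =>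
      partialSum_nonneg_of_mem_posRoots (simpleRoots_subset_posRoots hα) t
  have h0 : 0 ≤ partialSum t (y - x) := hle h
  rwa [map_sub, sub_nonneg] at h0

theorem RootLE.le_and_lt_of_sub {i j k l : Fin (n + 1)} (hkl : k < l)
    (h : RootLE (e k - e l) (e i - e j)) : i ≤ k ∧ k < j := by
  have hs := h.partialSum_le k
  simp only [map_sub, partialSum_e, le_refl, if_true, hkl.not_ge, if_false, sub_zero] at hs
  split_ifs at hs with h1 h2 h2 <;> first | exact ⟨h1, not_le.mp h2⟩ | norm_num at hs

/-! ### Obstruction to rationality -/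

/-- If `S ⊆ u(Adj S)`, then `S` persists in every `ν_k(u)`. -/
theorem IsRational.eq_empty_of_subset_image_adj (hu : IsRational u) {S : Set (V n)}
    (hpos : S ⊆ posRoots n) (hS : S ⊆ u '' adj S) : S = ∅ := by
  obtain ⟨-, N, hN⟩ := hu
  have hnu (k) : S ⊆ nu u k := by
    induction k with
    | zero => exact Set.subset_inter (hS.trans (Set.image_mono fun _ hγ => hγ.1)) hpos
    | succ k ih =>
      refine Set.subset_inter (hS.trans (Set.image_mono ?_)) hpos
      rintro γ ⟨hγ, β, hβ, hle⟩
      exact ⟨hγ, β, ih hβ, hle⟩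
  exact Set.subset_empty_iff.mp (hN N le_rfl ▸ hnu N)

theorem IsRational.not_rootLE_apply (hu : IsRational u) {x : V n} (hx : x ∈ posRoots n)
    (hux : u x ∈ posRoots n) : ¬ RootLE x (u x) := fun hle =>
  Set.singleton_ne_empty (u x) <| hu.eq_empty_of_subset_image_adj
    (Set.singleton_subset_iff.mpr hux)
    (Set.singleton_subset_iff.mpr ⟨x, ⟨hx, u x, rfl, hle⟩, rfl⟩)

theorem nu_eq_empty_of_le {N k : ℕ} (h : nu u N = ∅) (hk : N ≤ k) : nu u k = ∅ := by
  induction k, hk using Nat.le_induction with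
  | base => exact h
  | succ k _ ih => simp [nu, ih, adj]

/-! ### Permutations raising all indices but the last -/

theorem perm_eq_of_forall_ne {α : Type*} [Finite α] {σ τ : Equiv.Perm α} {a : α}
    (h : ∀ b ≠ a, σ b = τ b) : σ = τ := by
  classical
  have := Fintype.ofFinite α
  rw [← inv_mul_eq_one, ← Equiv.Perm.card_support_le_one]
  refine (Finset.card_le_card fun b hb => ?_).trans_eq (Finset.card_singleton a)
  rw [Equiv.Perm.mem_support, Equiv.Perm.mul_apply, Ne, Equiv.Perm.inv_eq_iff_eq] at hb
  exact Finset.mem_singleton.mpr (by_contra fun hba => hb (h b hba).symm)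

theorem card_filter_cross_up_eq_card_filter_cross_down {α : Type*} [Fintype α] [LinearOrder α]
    (σ : Equiv.Perm α) (x : α) :
    (Finset.univ.filter fun i => i ≤ x ∧ x < σ i).card =
      (Finset.univ.filter fun i => x < i ∧ σ i ≤ x).card := by
  have hcard : (Finset.univ.filter (· ≤ x)).card = (Finset.univ.filter (σ · ≤ x)).card :=
    (Finset.card_equiv σ (by simp)).symm
  convert Finset.card_sdiff_comm hcard using 2 <;> ext i <;> simp [and_comm]

/-- `π` maps no index below itself, except possibly the last one. -/
def IsRaising (π : Equiv.Perm (Fin (n + 1))) : Prop := ∀ j, j ≠ Fin.last n → j ≤ π j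

theorem IsRaising.cross_down_subset (h : IsRaising π) (x : Fin (n + 1)) :
    (Finset.univ.filter fun i => x < i ∧ π i ≤ x) ⊆ {Fin.last n} := by
  intro i hi
  rw [Finset.mem_filter] at hi
  by_contra hl
  exact ((h i (Finset.mem_singleton.not.mp hl)).trans hi.2.2).not_gt hi.2.1

theorem IsRaising.eq_of_cross (h : IsRaising π) {i j x : Fin (n + 1)} (hi : i ≤ x)
    (hx : x < π i) (hj : j ≤ x) (hx' : x < π j) : i = j := by
  have hcard := Finset.card_le_card (h.cross_down_subset x)
  rw [← card_filter_cross_up_eq_card_filter_cross_down, Finset.card_singleton] at hcard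
  exact Finset.card_le_one.mp hcard i (by simp [hi, hx]) j (by simp [hj, hx'])

theorem IsRaising.apply_last_le (h : IsRaising π) {i : Fin (n + 1)} (hi : i < π i) :
    π (Fin.last n) ≤ i := by
  have hpos : 0 < (Finset.univ.filter fun j => j ≤ i ∧ i < π j).card :=
    Finset.card_pos.mpr ⟨i, by simp [hi]⟩
  rw [card_filter_cross_up_eq_card_filter_cross_down] at hpos
  obtain ⟨j, hj⟩ := Finset.card_pos.mp hpos
  obtain rfl := Finset.mem_singleton.mp (h.cross_down_subset i hj)
  exact (Finset.mem_filter.mp hj).2.2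

theorem IsRaising.apply_le (h : IsRaising π) {i j : Fin (n + 1)} (hij : i < j) (hj : π j ≠ j) :
    π i ≤ j := by
  by_contra! hlt
  have hup : j < π j := (h j (hlt.trans_le (Fin.le_last _)).ne).lt_of_ne' hj
  exact hij.ne (h.eq_of_cross hij.le hlt le_rfl hup)

theorem IsRaising.apply_eq_self (h : IsRaising π) {i j : Fin (n + 1)} (hij : i < j)
    (hj : j < π i) : π j = j :=
  by_contra fun hne => (h.apply_le hij hne).not_gt hj

/-- The indices other than the last one that `π` moves; it recovers `I` from `p_I`. -/
def moved (π : Equiv.Perm (Fin (n + 1))) : Finset (Fin n) :=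
  {j | π j.castSucc ≠ j.castSucc}

theorem mem_moved {j : Fin n} : j ∈ moved π ↔ π j.castSucc ≠ j.castSucc := by simp [moved]

theorem apply_eq_self_iff_of_moved_eq {σ τ : Equiv.Perm (Fin (n + 1))} (h : moved σ = moved τ)
    {j : Fin (n + 1)} (hj : j ≠ Fin.last n) : σ j = j ↔ τ j = j := by
  obtain ⟨j, rfl⟩ := Fin.exists_castSucc_eq.mpr hj
  have hiff := Finset.ext_iff.mp h j
  rwa [mem_moved, mem_moved, not_iff_not] at hiff

/-- A raising permutation sends a moved index `j < r` to the least larger index that is moved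
or equal to `r`. -/
theorem IsRaising.eq_of_moved_eq {σ τ : Equiv.Perm (Fin (n + 1))} (hσ : IsRaising σ)
    (hτ : IsRaising τ) (h : moved σ = moved τ) : σ = τ := by
  have key {σ τ : Equiv.Perm (Fin (n + 1))} (hσ : IsRaising σ) (hτ : IsRaising τ)
      (h : moved σ = moved τ) {j : Fin (n + 1)} (hj : j ≠ Fin.last n) : σ j ≤ τ j := by
    by_cases hfix : τ j = j
    · rw [hfix, (apply_eq_self_iff_of_moved_eq h hj).mpr hfix]
    by_cases hl : τ j = Fin.last n
    · exact hl ▸ Fin.le_last _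
    have hmoved : τ (τ j) ≠ τ j := fun hττ => hfix (τ.injective hττ)
    exact hσ.apply_le ((hτ j hj).lt_of_ne' hfix)
      ((apply_eq_self_iff_of_moved_eq h hl).not.mpr hmoved)
  exact perm_eq_of_forall_ne fun j hj => (key hσ hτ h hj).antisymm (key hτ hσ h.symm hj)

theorem IsRaising.swap_mul_iff (h : IsRaising π) {a : Fin n} :
    IsRaising (Equiv.swap a.castSucc a.succ * π) ↔
      (a.succ ≠ Fin.last n → π a.succ ≠ a.succ) := by
  constructor
  · intro h' hl hfix
    have hle := h' a.succ hl
    rw [Equiv.Perm.mul_apply, hfix, Equiv.swap_apply_right] at hle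
    exact hle.not_gt a.castSucc_lt_succ
  · intro hsucc j hj
    have hle := h j hj
    rw [Equiv.Perm.mul_apply, Equiv.swap_apply_def]
    split_ifs with h1 h2
    · exact (h1 ▸ hle).trans a.castSucc_lt_succ.le
    · rw [Fin.le_castSucc_iff]
      refine (h2 ▸ hle).lt_of_ne ?_
      rintro rfl
      exact hsucc hj h2
    · exact hle

theorem IsRaising.swap_mul_apply_eq_self (h : IsRaising π) {a : Fin n}
    (h' : IsRaising (Equiv.swap a.castSucc a.succ * π)) {j : Fin n} (hja : j ≠ a)
    (hj : π j.castSucc = j.castSucc) :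
    (Equiv.swap a.castSucc a.succ * π) j.castSucc = j.castSucc := by
  rw [Equiv.Perm.mul_apply, hj]
  refine Equiv.swap_apply_of_ne_of_ne ((Fin.castSucc_injective n).ne hja) fun hjs => ?_
  exact h.swap_mul_iff.mp h' (hjs ▸ Fin.castSucc_ne_last j) (hjs ▸ hj)

theorem IsRaising.apply_castSucc_eq_succ_iff (h : IsRaising π) {a : Fin n}
    (h' : IsRaising (Equiv.swap a.castSucc a.succ * π)) :
    π a.castSucc = a.succ ↔ π a.castSucc ≠ a.castSucc := by
  refine ⟨fun heq => heq ▸ a.castSucc_lt_succ.ne', fun hne => ?_⟩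
  have hlt := (h _ (Fin.castSucc_ne_last a)).lt_of_ne' hne
  refine le_antisymm ?_ (Fin.castSucc_lt_iff_succ_le.mp hlt)
  by_cases hl : a.succ = Fin.last n
  · exact hl ▸ Fin.le_last _
  · exact h.apply_le a.castSucc_lt_succ (h.swap_mul_iff.mp h' hl)

theorem IsRaising.moved_swap_mul (h : IsRaising π) {a : Fin n}
    (h' : IsRaising (Equiv.swap a.castSucc a.succ * π)) :
    moved (Equiv.swap a.castSucc a.succ * π) = symmDiff (moved π) {a} := by
  ext j
  rw [Finset.mem_symmDiff, Finset.mem_singleton, mem_moved, mem_moved]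
  by_cases hja : j = a
  · subst hja
    have hfix : (Equiv.swap j.castSucc j.succ * π) j.castSucc = j.castSucc ↔
        π j.castSucc = j.succ := by
      rw [Equiv.Perm.mul_apply, Equiv.swap_apply_eq_iff, Equiv.swap_apply_left]
    rw [Ne, hfix, h.apply_castSucc_eq_succ_iff h']
    tauto
  · have hπ : Equiv.swap a.castSucc a.succ * (Equiv.swap a.castSucc a.succ * π) = π :=
      Equiv.swap_mul_self_mul _ _ _
    have hback := h'.swap_mul_apply_eq_self (a := a) (by rwa [hπ]) hja
    rw [hπ] at hback
    have := h.swap_mul_apply_eq_self h' hja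
    tauto

/-! ### The cycles `p I` -/

theorem pairwise_lt_sort_append_last (I : Finset (Fin n)) :
    ((I.sort (· ≤ ·)).map Fin.castSucc ++ [Fin.last n]).Pairwise (· < ·) := by
  rw [List.pairwise_append, List.pairwise_map]
  refine ⟨I.sortedLT_sort.pairwise.imp Fin.castSucc_lt_castSucc_iff.mpr,
    List.pairwise_singleton _ _, ?_⟩
  simp only [List.mem_map, List.mem_singleton]
  rintro _ ⟨i, -, rfl⟩ _ rfl
  exact Fin.castSucc_lt_last i

theorem lt_p_apply {I : Finset (Fin n)} {i : Fin n} (hi : i ∈ I) :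
    i.castSucc < p I i.castSucc := by
  have hsorted := pairwise_lt_sort_append_last I
  have hmem : i.castSucc ∈ (I.sort (· ≤ ·)).map Fin.castSucc := by simp [hi]
  obtain ⟨k, hk, hki⟩ := List.getElem_of_mem hmem
  have hlen : k + 1 < ((I.sort (· ≤ ·)).map Fin.castSucc ++ [Fin.last n]).length := by
    rw [List.length_append, List.length_singleton]
    lia
  have hget : ((I.sort (· ≤ ·)).map Fin.castSucc ++ [Fin.last n])[k] = i.castSucc := by
    rw [List.getElem_append_left hk, hki]
  have hnext := List.formPerm_apply_lt_getElem _ hsorted.nodup k hlen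
  rw [hget] at hnext
  rw [p, hnext, ← hget]
  exact List.pairwise_iff_getElem.mp hsorted _ _ _ _ (Nat.lt_succ_self k)

theorem p_apply_eq_self_iff {I : Finset (Fin n)} {i : Fin n} :
    p I i.castSucc = i.castSucc ↔ i ∉ I :=
  ⟨fun h hi => (lt_p_apply hi).ne' h,
    fun hi => List.formPerm_apply_of_notMem (by simp [hi, Fin.castSucc_ne_last])⟩

theorem moved_p (I : Finset (Fin n)) : moved (p I) = I := by
  ext i
  rw [mem_moved, Ne, p_apply_eq_self_iff, not_not]

theorem isRaising_p (I : Finset (Fin n)) : IsRaising (p I) := by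
  intro j hj
  obtain ⟨i, rfl⟩ := Fin.exists_castSucc_eq.mpr hj
  by_cases hi : i ∈ I
  · exact (lt_p_apply hi).le
  · exact (p_apply_eq_self_iff.mpr hi).ge

theorem IsRaising.eq_p (h : IsRaising π) : π = p (moved π) :=
  h.eq_of_moved_eq (isRaising_p _) (moved_p _).symm

theorem p_injective : Function.Injective (p : Finset (Fin n) → Equiv.Perm (Fin (n + 1))) :=
  Function.LeftInverse.injective moved_p

theorem p_empty : p (∅ : Finset (Fin n)) = 1 := by simp [p]

theorem p_max' {I : Finset (Fin n)} (h : I.Nonempty) :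
    p I (I.max' h).castSucc = Fin.last n := by
  have hlt := lt_p_apply (I.max'_mem h)
  by_contra hne
  obtain ⟨j, hj⟩ := Fin.exists_castSucc_eq.mpr hne
  have hjI : j ∉ I := fun hjI => (I.le_max' j hjI).not_gt
    (Fin.castSucc_lt_castSucc_iff.mp (hlt.trans_eq hj.symm))
  have hfix := p_apply_eq_self_iff.mpr hjI
  rw [hj] at hfix
  exact hlt.ne' ((p I).injective hfix)

theorem p_symm_last_eq_last_iff {I : Finset (Fin n)} :
    (p I).symm (Fin.last n) = Fin.last n ↔ I = ∅ := by
  refine ⟨fun h => ?_, fun h => by rw [h, p_empty]; rfl⟩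
  by_contra hI
  have hmax := p_max' (Finset.nonempty_iff_ne_empty.mpr hI)
  rw [← Equiv.eq_symm_apply, h] at hmax
  exact Fin.castSucc_ne_last _ hmax

/-- `a + 1 ∈ I ∪ {r}`: the condition for `I` and `I ∆ {a}` to give adjacent vertices. -/
def Toggleable (I : Finset (Fin n)) (a : Fin n) : Prop :=
  a.succ = Fin.last n ∨ ∃ b ∈ I, (b : ℕ) = a + 1

theorem toggleable_iff {I : Finset (Fin n)} {a : Fin n} :
    Toggleable I a ↔ (a.succ ≠ Fin.last n → p I a.succ ≠ a.succ) := by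
  rw [Toggleable, or_iff_not_imp_left]
  refine forall_congr' fun ha => ?_
  obtain ⟨b, hb⟩ := Fin.exists_castSucc_eq.mpr ha
  have hb' : (b : ℕ) = a + 1 := congrArg Fin.val hb
  rw [← hb, Ne, p_apply_eq_self_iff, not_not]
  exact ⟨fun ⟨b', hbI, hval⟩ => Fin.ext (hb'.trans hval.symm) ▸ hbI, fun hbI => ⟨b, hbI, hb'⟩⟩

theorem toggleable_iff_mem {I : Finset (Fin n)} {a b : Fin n} (hab : (b : ℕ) = a + 1) :
    Toggleable I a ↔ b ∈ I := by
  have hsucc : b.castSucc = a.succ := Fin.ext hab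
  rw [toggleable_iff, ← hsucc, Ne, Ne, p_apply_eq_self_iff, not_not]
  exact ⟨fun h => h (Fin.castSucc_ne_last b), fun h _ => h⟩

theorem isRaising_swap_mul_p_iff {I : Finset (Fin n)} {a : Fin n} :
    IsRaising (Equiv.swap a.castSucc a.succ * p I) ↔ Toggleable I a :=
  (isRaising_p I).swap_mul_iff.trans toggleable_iff.symm

theorem Toggleable.swap_mul_p {I : Finset (Fin n)} {a : Fin n} (h : Toggleable I a) :
    Equiv.swap a.castSucc a.succ * p I = p (symmDiff I {a}) := by
  have hraise := isRaising_swap_mul_p_iff.mpr h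
  rw [hraise.eq_p, (isRaising_p I).moved_swap_mul hraise, moved_p]

/-! ### Signs -/

/-- The sign vector that is `1` at `x` and `-1` elsewhere. -/
def signAt (x : Fin (n + 1)) : Fin (n + 1) → ℤˣ := fun j => if j = x then 1 else -1

theorem signAt_self (x : Fin (n + 1)) : signAt x x = 1 := if_pos rfl

theorem signAt_of_ne {x j : Fin (n + 1)} (h : j ≠ x) : signAt x j = -1 := if_neg h

theorem signAt_injective : Function.Injective (signAt : Fin (n + 1) → _) := by
  intro x y h
  by_contra hxy
  have hx := congrFun h x
  rw [signAt_self, signAt_of_ne hxy] at hx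
  exact absurd hx (by decide)

theorem prod_signAt (hn : Even n) (x : Fin (n + 1)) : ∏ j, signAt x j = 1 := by
  simp [signAt, Finset.prod_ite, Finset.filter_ne', hn.neg_one_pow]

theorem eq_signAt_of_forall_ne (hn : Even n) (hprod : ∏ j, ε j = 1) {x : Fin (n + 1)}
    (h : ∀ j ≠ x, ε j = -1) : ε = signAt x := by
  have hoff : ∀ j ≠ x, ε j = signAt x j := fun j hj => (h j hj).trans (signAt_of_ne hj).symm
  funext j
  by_cases hj : j = x
  · have heq : ∏ j, ε j = ∏ j, signAt x j := hprod.trans (prod_signAt hn x).symm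
    rw [← Finset.mul_prod_erase _ _ (Finset.mem_univ x),
      ← Finset.mul_prod_erase _ (signAt x) (Finset.mem_univ x),
      Finset.prod_congr rfl fun j hj => hoff j (Finset.ne_of_mem_erase hj), mul_left_inj] at heq
    exact hj ▸ heq
  · exact hoff j hj

theorem eq_signAt_or_eq_signAt (hn : Even n) (hprod : ∏ j, ε j = 1) {x y : Fin (n + 1)}
    (h : ∀ j, j ≠ x → j ≠ y → ε j = -1) : ε = signAt x ∨ ε = signAt y := by
  by_cases hx : ε x = -1
  · refine .inr (eq_signAt_of_forall_ne hn hprod fun j hy => ?_)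
    by_cases hjx : j = x
    exacts [hjx ▸ hx, h j hjx hy]
  by_cases hy : y ≠ x → ε y = -1
  · refine .inl (eq_signAt_of_forall_ne hn hprod fun j hx => ?_)
    by_cases hjy : j = y
    exacts [hjy ▸ hy (hjy ▸ hx), h j hx hjy]
  push Not at hy
  have hpos {j} (hj : ε j ≠ -1) : ε j = 1 := (Int.units_eq_one_or _).resolve_right hj
  have hneg : ∏ j, -ε j = 1 := by
    rw [Finset.prod_eq_mul y x hy.1 (fun j _ hj => by rw [h j hj.2 hj.1, neg_neg]) (by simp)
      (by simp), hpos hx, hpos hy.2]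
    decide
  rw [Finset.prod_neg, hprod, Finset.card_univ, Fintype.card_fin, hn.add_one.neg_one_pow] at hneg
  exact absurd hneg (by decide)

theorem c_eq (I : Finset (Fin n)) : c I = signedPerm (p I) (signAt (Fin.last n)) := by
  rcases I.eq_empty_or_nonempty with rfl | h
  · rw [c, if_neg Finset.not_nonempty_empty, p_empty]; rfl
  · rw [c, if_pos h]; rfl

theorem d_eq (I : Finset (Fin n)) :
    d I = signedPerm (p I) (signAt ((p I).symm (Fin.last n))) := by
  rcases I.eq_empty_or_nonempty with rfl | h
  · rw [d, dif_neg Finset.not_nonempty_empty, p_empty]; rfl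
  · rw [d, dif_pos h, ← p_max' h, Equiv.symm_apply_apply]; rfl

/-! ### Rational elements belong to the family -/

theorem IsRational.lt_apply_of_sign_eq_one (hu : IsRational (signedPerm π ε))
    {a : Fin (n + 1)} (ha : a ≠ Fin.last n) (hε : ε a = 1) : a < π a := by
  by_contra! hle
  have hal : a < Fin.last n := Fin.lt_last_iff_ne_last.mpr ha
  by_cases hl : π (Fin.last n) = Fin.last n
  · have hπa : π a < Fin.last n := hle.trans_lt hal
    refine (Set.range_nonempty fun s : ℤˣ => e (π a) + s • e (Fin.last n)).ne_empty
      (hu.eq_empty_of_subset_image_adj ?_ ?_)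
    · rintro _ ⟨s, rfl⟩
      exact e_add_units_smul_e_mem_posRoots hπa s
    · rintro _ ⟨s, rfl⟩
      refine ⟨e a + (s * ε (Fin.last n)) • e (Fin.last n),
        ⟨e_add_units_smul_e_mem_posRoots hal _, _, ⟨_, rfl⟩, (rootLE_e hle).add (.refl _)⟩, ?_⟩
      rw [signedPerm_e_add_units_smul_e, hε, hl, one_smul, mul_assoc, Int.units_mul_self, mul_one]
  · have him : signedPerm π ε (e a + ε (Fin.last n) • e (Fin.last n)) =
        e (π a) + e (π (Fin.last n)) := by
      rw [signedPerm_e_add_units_smul_e, hε, Int.units_mul_self, one_smul, one_smul]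
    refine hu.not_rootLE_apply (e_add_units_smul_e_mem_posRoots hal _)
      (him ▸ e_add_e_mem_posRoots (π.injective.ne ha)) ?_
    rw [him]
    exact (rootLE_e hle).add (rootLE_units_smul_e (Fin.le_last _) hl _)

theorem IsRational.apply_lt_of_sign_eq_neg_one (hu : IsRational (signedPerm π ε))
    {a i : Fin (n + 1)} (ha : a ≠ Fin.last n) (hε : ε a = -1) (hi : π a ≤ i) (hia : i < a) :
    π i < a := by
  by_contra! hai
  have him : signedPerm π ε (e i - e a) = e (π a) + ε i • e (π i) := by
    rw [map_sub, signedPerm_e_eq_units_smul, signedPerm_e_eq_units_smul, hε, Units.neg_smul,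
      one_smul, sub_neg_eq_add, add_comm]
  refine hu.not_rootLE_apply (e_sub_e_mem_posRoots hia)
    (him ▸ e_add_units_smul_e_mem_posRoots ((hi.trans_lt hia).trans_le hai) _) ?_
  have hneg := (rootLE_units_smul_e hai ha (-ε i)).neg
  rw [Units.neg_smul, neg_neg] at hneg
  rw [him, sub_eq_add_neg]
  exact (rootLE_e hi).add hneg

theorem IsRational.isRaising (hu : IsRational (signedPerm π ε)) : IsRaising π := by
  have key (b : Fin (n + 1)) : ∀ a ≠ Fin.last n, π a = b → a ≤ b := by
    induction b using WellFoundedLT.induction with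
    | ind b ih =>
      rintro a ha rfl
      by_contra! hlt
      have hε : ε a = -1 := (Int.units_eq_one_or (ε a)).resolve_left fun h =>
        (hu.lt_apply_of_sign_eq_one ha h).not_gt hlt
      have hmaps : Set.MapsTo π (Finset.Icc (π a) a) (Finset.Ico (π a) a) := by
        simp only [Finset.coe_Icc, Finset.coe_Ico]
        rintro i ⟨hi, hia⟩
        refine ⟨not_lt.mp fun hπi => ?_, ?_⟩
        · have hil : i ≠ Fin.last n :=
            (hia.trans_lt (Fin.lt_last_iff_ne_last.mpr ha)).ne
          exact ((ih _ hπi i hil rfl).trans_lt hπi).not_ge hi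
        · rcases hia.eq_or_lt with rfl | hia
          exacts [hlt, hu.apply_lt_of_sign_eq_neg_one ha hε hi hia]
      have hcard := Finset.card_le_card_of_injOn π hmaps π.injective.injOn
      rw [← Finset.Ico_insert_right hlt.le, Finset.card_insert_of_notMem
        Finset.right_notMem_Ico] at hcard
      lia
  exact fun j hj => key _ j hj rfl

theorem IsRational.apply_eq_last (hu : IsRational (signedPerm π ε)) {a : Fin (n + 1)}
    (ha : a ≠ Fin.last n) (hε : ε a = 1) : π a = Fin.last n := by
  by_contra hl
  have hle : π (Fin.last n) ≤ a := hu.isRaising.apply_last_le (hu.lt_apply_of_sign_eq_one ha hε)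
  have him : signedPerm π ε (e a + ε (Fin.last n) • e (Fin.last n)) =
      e (π (Fin.last n)) + e (π a) := by
    rw [signedPerm_e_add_units_smul_e, hε, Int.units_mul_self, one_smul, one_smul, add_comm]
  refine hu.not_rootLE_apply (e_add_units_smul_e_mem_posRoots (Fin.lt_last_iff_ne_last.mpr ha) _)
    (him ▸ e_add_e_mem_posRoots (π.injective.ne ha.symm)) ?_
  rw [him]
  exact (rootLE_e hle).add (rootLE_units_smul_e (Fin.le_last _) hl _)

theorem IsRational.eq_last_of_apply_e (hu : IsRational u) {i j : Fin (n + 1)}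
    (hi : i ≠ Fin.last n) (h : u (e i) = e j) : j = Fin.last n := by
  obtain ⟨π, ε, -, rfl⟩ := hu.1
  rw [signedPerm_e_eq_units_smul, ← one_smul ℤˣ (e j), units_smul_e_inj] at h
  exact h.2 ▸ hu.apply_eq_last hi h.1

theorem IsRational.exists_eq (hn : Even n) (hu : IsRational u) :
    ∃ I : Finset (Fin n), u = c I ∨ u = d I := by
  obtain ⟨π, ε, hε, rfl⟩ := hu.1
  have hπ : π = p (moved π) := hu.isRaising.eq_p
  have hneg (j) (hj : j ≠ Fin.last n) (hj' : j ≠ π.symm (Fin.last n)) : ε j = -1 :=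
    (Int.units_eq_one_or (ε j)).resolve_left fun h =>
      hj' (π.eq_symm_apply.mpr (hu.apply_eq_last hj h))
  refine ⟨moved π, ?_⟩
  rw [c_eq, d_eq, ← hπ]
  exact (eq_signAt_or_eq_signAt hn ((even_iff_prod ε).mp hε) hneg).imp (congrArg _) (congrArg _)

/-! ### Members of the family are rational -/

theorem le_of_e_sub_e_mem_posRoots {i j : Fin (n + 1)} (h : e i - e j ∈ posRoots n) : i ≤ j := by
  have hs := partialSum_nonneg_of_mem_posRoots h j
  rw [map_sub, partialSum_e, partialSum_e, if_pos le_rfl] at hs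
  by_contra hij
  norm_num [hij] at hs

theorem exists_eq_e_sub_e_of_mem_posRoots {x : V n} (hx : x ∈ posRoots n)
    (hs : partialSum (Fin.last n) x ≤ 0) : ∃ i j, i < j ∧ x = e i - e j := by
  obtain hx | ⟨i, j, -, rfl⟩ := hx
  · exact hx
  · norm_num [partialSum_e, Fin.le_last] at hs

theorem partialSum_last_signedPerm_signAt_nonpos {x : V n} (hx : x ∈ posRoots n) :
    partialSum (Fin.last n) (signedPerm π (signAt (Fin.last n)) x) ≤ 0 := by
  obtain ⟨i, j, h, s, rfl⟩ := mem_posRoots_iff.mp hx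
  rw [signedPerm_e_add_units_smul_e, signAt_of_ne (Fin.ne_last_of_lt h), map_add,
    partialSum_last_units_smul_e, partialSum_last_units_smul_e]
  rcases Int.units_eq_one_or (s * signAt (Fin.last n) j) with hs | hs <;> norm_num [hs]

theorem nu_subset_image_posRoots (u : V n ≃ₗ[ℝ] V n) (k : ℕ) : nu u k ⊆ u '' posRoots n := by
  cases k with
  | zero => exact Set.inter_subset_left
  | succ k => exact Set.inter_subset_left.trans (Set.image_mono fun _ hx => hx.1)

theorem exists_eq_e_sub_e_of_mem_adj_nu {k : ℕ} {x : V n}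
    (hx : x ∈ adj (nu (signedPerm π (signAt (Fin.last n))) k)) :
    ∃ i j, i < j ∧ x = e i - e j := by
  obtain ⟨hpos, β, hβ, hle⟩ := hx
  obtain ⟨z, hz, rfl⟩ := nu_subset_image_posRoots _ k hβ
  exact exists_eq_e_sub_e_of_mem_posRoots hpos
    ((hle.partialSum_le _).trans (partialSum_last_signedPerm_signAt_nonpos hz))

theorem IsRaising.lt_apply_and_apply_e_sub_e (h : IsRaising π) {i j : Fin (n + 1)} (hij : i < j)
    (hpos : signedPerm π (signAt (Fin.last n)) (e i - e j) ∈ posRoots n) :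
    j < π i ∧ signedPerm π (signAt (Fin.last n)) (e i - e j) = e j - e (π i) := by
  have him : signedPerm π (signAt (Fin.last n)) (e i - e j) =
      -e (π i) - signAt (Fin.last n) j • e (π j) := by
    rw [map_sub, signedPerm_e_eq_units_smul, signedPerm_e_eq_units_smul,
      signAt_of_ne (Fin.ne_last_of_lt hij), Units.neg_smul, one_smul]
  have hj : j ≠ Fin.last n := by
    rintro rfl
    have hs := partialSum_nonneg_of_mem_posRoots hpos (Fin.last n)
    norm_num [him, signAt_self, partialSum_e, Fin.le_last] at hs
  rw [signAt_of_ne hj, Units.neg_smul, one_smul, sub_neg_eq_add, neg_add_eq_sub] at him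
  have hlt : j < π i := (h j hj).trans_lt
    ((le_of_e_sub_e_mem_posRoots (him ▸ hpos)).lt_of_ne (π.injective.ne hij.ne'))
  exact ⟨hlt, by rw [him, h.apply_eq_self hij hlt]⟩

theorem IsRaising.exists_of_mem_nu_succ (h : IsRaising π) {k : ℕ} {y : V n}
    (hy : y ∈ nu (signedPerm π (signAt (Fin.last n))) (k + 1)) :
    ∃ i j, i < j ∧ j < π i ∧ e i - e j ∈ adj (nu (signedPerm π (signAt (Fin.last n))) k) ∧
      y = e j - e (π i) := by
  obtain ⟨⟨x, hx, rfl⟩, hpos⟩ := hy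
  obtain ⟨i, j, hij, rfl⟩ := exists_eq_e_sub_e_of_mem_adj_nu hx
  obtain ⟨hlt, heq⟩ := h.lt_apply_and_apply_e_sub_e hij hpos
  exact ⟨i, j, hij, hlt, hx, heq⟩

theorem IsRaising.nu_two_eq_empty (h : IsRaising π) :
    nu (signedPerm π (signAt (Fin.last n))) 2 = ∅ := by
  refine Set.eq_empty_of_forall_notMem fun y hy => ?_
  obtain ⟨k, l, hkl, hl, ⟨-, β, hβ, hle⟩, -⟩ := h.exists_of_mem_nu_succ hy
  obtain ⟨i, j, hij, -, -, rfl⟩ := h.exists_of_mem_nu_succ hβ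
  obtain ⟨hjk, hki⟩ := hle.le_and_lt_of_sub hkl
  have hfix : π k = k := h.apply_eq_self (hij.trans_le hjk) hki
  exact (hfix ▸ hl).not_gt hkl

theorem isRational_c (hn : Even n) (I : Finset (Fin n)) : IsRational (c I) := by
  rw [c_eq]
  exact ⟨⟨p I, _, (even_iff_prod _).mpr (prod_signAt hn _), rfl⟩, 2,
    fun k hk => nu_eq_empty_of_le (isRaising_p I).nu_two_eq_empty hk⟩

/-! ### The diagram automorphism -/

/-- The automorphism `e_r ↦ -e_r` of the Dynkin diagram, which exchanges the simple roots
`α_{r-1}` and `α_r`. -/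
def diagramAut (n : ℕ) : V n ≃ₗ[ℝ] V n := signedPerm 1 (-signAt (Fin.last n))

theorem diagramAut_diagramAut (x : V n) : diagramAut n (diagramAut n x) = x := by
  ext i
  change ((-signAt (Fin.last n) i : ℤˣ) : ℝ) * (((-signAt (Fin.last n) i : ℤˣ) : ℝ) * x i) = x i
  rcases Int.units_eq_one_or (signAt (Fin.last n) i) with h | h <;> simp [h]

theorem diagramAut_e_add_units_smul_e {i : Fin (n + 1)} (hi : i ≠ Fin.last n)
    (j : Fin (n + 1)) (s : ℤˣ) :
    diagramAut n (e i + s • e j) = e i + (s * -signAt (Fin.last n) j) • e j := by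
  rw [diagramAut, signedPerm_e_add_units_smul_e, Pi.neg_apply, signAt_of_ne hi, neg_neg, one_smul]
  rfl

theorem diagramAut_mem_posRoots {x : V n} (hx : x ∈ posRoots n) :
    diagramAut n x ∈ posRoots n := by
  obtain ⟨i, j, h, s, rfl⟩ := mem_posRoots_iff.mp hx
  rw [diagramAut_e_add_units_smul_e (Fin.ne_last_of_lt h)]
  exact e_add_units_smul_e_mem_posRoots h _

theorem mem_simpleRoots_iff {x : V n} :
    x ∈ simpleRoots n ↔ ∃ (i : Fin n) (s : ℤˣ), (i.succ ≠ Fin.last n → s = -1) ∧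
      x = e i.castSucc + s • e i.succ := by
  constructor
  · rintro (⟨i, rfl⟩ | ⟨i, hi, rfl⟩)
    · exact ⟨i, -1, fun _ => rfl, by simp [sub_eq_add_neg]⟩
    · exact ⟨i, 1, fun h => absurd hi h, by simp⟩
  · rintro ⟨i, s, hs, rfl⟩
    rcases Int.units_eq_one_or s with rfl | rfl
    · exact Or.inr ⟨i, by_contra fun h => absurd (hs h) (by decide), by simp⟩
    · exact Or.inl ⟨i, by simp [sub_eq_add_neg]⟩

theorem diagramAut_mem_simpleRoots {x : V n} (hx : x ∈ simpleRoots n) :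
    diagramAut n x ∈ simpleRoots n := by
  obtain ⟨i, s, hs, rfl⟩ := mem_simpleRoots_iff.mp hx
  refine mem_simpleRoots_iff.mpr ⟨i, s * -signAt (Fin.last n) i.succ, fun hi => ?_,
    diagramAut_e_add_units_smul_e (Fin.castSucc_ne_last i) _ _⟩
  rw [hs hi, signAt_of_ne hi]
  rfl

theorem RootLE.map_diagramAut {x y : V n} (h : RootLE x y) :
    RootLE (diagramAut n x) (diagramAut n y) := by
  have hle : AddSubmonoid.closure (simpleRoots n) ≤
      (AddSubmonoid.closure (simpleRoots n)).comap (diagramAut n) :=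
    AddSubmonoid.closure_le.mpr fun α hα =>
      AddSubmonoid.subset_closure (diagramAut_mem_simpleRoots hα)
  rw [RootLE, ← map_sub]
  exact hle h

theorem diagramAut_image_posRoots : diagramAut n '' posRoots n = posRoots n :=
  (Set.image_subset_iff.mpr fun _ => diagramAut_mem_posRoots).antisymm fun x hx =>
    ⟨diagramAut n x, diagramAut_mem_posRoots hx, diagramAut_diagramAut x⟩

theorem adj_diagramAut_image (S : Set (V n)) :
    adj (diagramAut n '' S) = diagramAut n '' adj S := by
  ext x
  constructor
  · rintro ⟨hx, _, ⟨β, hβ, rfl⟩, hle⟩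
    have hle' := hle.map_diagramAut
    rw [diagramAut_diagramAut] at hle'
    exact ⟨diagramAut n x, ⟨diagramAut_mem_posRoots hx, β, hβ, hle'⟩, diagramAut_diagramAut x⟩
  · rintro ⟨x, ⟨hx, β, hβ, hle⟩, rfl⟩
    exact ⟨diagramAut_mem_posRoots hx, _, ⟨β, hβ, rfl⟩, hle.map_diagramAut⟩

/-- The conjugate of `u` by the diagram automorphism. -/
def twist (u : V n ≃ₗ[ℝ] V n) : V n ≃ₗ[ℝ] V n := diagramAut n * u * diagramAut n

theorem twist_apply (u : V n ≃ₗ[ℝ] V n) (x : V n) :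
    twist u x = diagramAut n (u (diagramAut n x)) := rfl

theorem twist_involutive : Function.Involutive (twist : (V n ≃ₗ[ℝ] V n) → _) := fun u => by
  ext1 x
  simp only [twist_apply, diagramAut_diagramAut]

theorem twist_image_diagramAut_image (u : V n ≃ₗ[ℝ] V n) (S : Set (V n)) :
    twist u '' (diagramAut n '' S) = diagramAut n '' (u '' S) := by
  simp only [Set.image_image, twist_apply, diagramAut_diagramAut]

theorem nu_twist (u : V n ≃ₗ[ℝ] V n) (k : ℕ) : nu (twist u) k = diagramAut n '' nu u k := by
  induction k with
  | zero =>
    rw [nu, nu, Set.image_inter (diagramAut n).injective, ← twist_image_diagramAut_image,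
      diagramAut_image_posRoots]
  | succ k ih =>
    rw [nu, nu, Set.image_inter (diagramAut n).injective, ← twist_image_diagramAut_image,
      diagramAut_image_posRoots, ih, adj_diagramAut_image]

theorem twist_signedPerm (π : Equiv.Perm (Fin (n + 1))) (ε : Fin (n + 1) → ℤˣ) :
    twist (signedPerm π ε) =
      signedPerm π fun j => signAt (Fin.last n) (π j) * (ε j * signAt (Fin.last n) j) := by
  rw [twist, diagramAut, signedPerm_mul_signedPerm, signedPerm_mul_signedPerm, one_mul, mul_one]
  congr! 2 with j
  simp [mul_assoc]

theorem twist_mem_W (hu : u ∈ W n) : twist u ∈ W n := by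
  obtain ⟨π, ε, hε, rfl⟩ := hu
  refine ⟨π, _, ?_, twist_signedPerm π ε⟩
  rw [even_iff_prod] at *
  rw [Finset.prod_mul_distrib, Finset.prod_mul_distrib, hε, one_mul,
    Equiv.prod_comp π (signAt (Fin.last n)), Int.units_mul_self]

theorem IsRational.twist (hu : IsRational u) : IsRational (twist u) := by
  obtain ⟨hW, N, hN⟩ := hu
  exact ⟨twist_mem_W hW, N, fun k hk => by rw [nu_twist, hN k hk, Set.image_empty]⟩

theorem twist_c (I : Finset (Fin n)) : twist (c I) = d I := by
  rw [c_eq, d_eq, twist_signedPerm]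
  congr! 2 with j
  rw [Int.units_mul_self, mul_one, signAt, signAt]
  simp only [Equiv.eq_symm_apply]

theorem twist_eq_c_iff {I : Finset (Fin n)} : twist u = c I ↔ u = d I := by
  rw [twist_involutive.eq_iff, twist_c]

theorem twist_eq_d_iff {I : Finset (Fin n)} : twist u = d I ↔ u = c I := by
  rw [← twist_c, twist_involutive.injective.eq_iff]

theorem isRational_d (hn : Even n) (I : Finset (Fin n)) : IsRational (d I) :=
  twist_c I ▸ (isRational_c hn I).twist

/-! ### The number of rational elements -/

theorem c_empty : c (∅ : Finset (Fin n)) = w0 n := if_neg Finset.not_nonempty_empty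

theorem d_empty : d (∅ : Finset (Fin n)) = w0 n := dif_neg Finset.not_nonempty_empty

theorem c_injective : Function.Injective (c : Finset (Fin n) → _) := fun I J h => by
  rw [c_eq, c_eq, signedPerm_inj] at h
  exact p_injective h.1

theorem d_injective : Function.Injective (d : Finset (Fin n) → _) := fun I J h => by
  rw [← twist_c, twist_eq_d_iff] at h
  exact c_injective h

theorem c_eq_d_iff {I J : Finset (Fin n)} : c I = d J ↔ I = ∅ ∧ J = ∅ := by
  constructor
  · intro h
    rw [c_eq, d_eq, signedPerm_inj, p_injective.eq_iff, signAt_injective.eq_iff,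
      eq_comm (a := Fin.last n), p_symm_last_eq_last_iff] at h
    exact ⟨h.1.trans h.2, h.2⟩
  · rintro ⟨rfl, rfl⟩
    rw [c_empty, d_empty]

theorem isRational_iff (hn : Even n) :
    IsRational u ↔ ∃ I : Finset (Fin n), u = c I ∨ u = d I := by
  refine ⟨IsRational.exists_eq hn, ?_⟩
  rintro ⟨I, rfl | rfl⟩
  exacts [isRational_c hn I, isRational_d hn I]

theorem setOf_isRational (hn : Even n) : {u : V n ≃ₗ[ℝ] V n | IsRational u} =
    {w0 n} ∪ {u | ∃ I : Finset (Fin n), I.Nonempty ∧ (u = c I ∨ u = d I)} := by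
  ext u
  rw [Set.mem_ofPred_eq, isRational_iff hn, Set.mem_union, Set.mem_singleton_iff,
    Set.mem_ofPred_eq]
  constructor
  · rintro ⟨I, hI⟩
    rcases I.eq_empty_or_nonempty with rfl | hne
    · exact .inl (by simpa only [c_empty, d_empty, or_self] using hI)
    · exact .inr ⟨I, hne, hI⟩
  · rintro (rfl | ⟨I, -, hI⟩)
    exacts [⟨∅, .inl c_empty.symm⟩, ⟨I, hI⟩]

theorem ncard_setOf_isRational (hn : Even n) :
    {u : V n ≃ₗ[ℝ] V n | IsRational u}.ncard = 2 ^ (n + 1) - 1 := by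
  have hunion : {u : V n ≃ₗ[ℝ] V n | IsRational u} = Set.range c ∪ Set.range d := by
    ext u
    simp only [Set.mem_ofPred_eq, isRational_iff hn, exists_or, Set.mem_union, Set.mem_range,
      eq_comm]
  have hinter : Set.range c ∩ Set.range d = {w0 n} := by
    ext u
    constructor
    · rintro ⟨⟨I, rfl⟩, J, hJ⟩
      rw [(c_eq_d_iff.mp hJ.symm).1]
      exact c_empty
    · rintro rfl
      exact ⟨⟨∅, c_empty⟩, ∅, d_empty⟩
  have hcard {f : Finset (Fin n) → V n ≃ₗ[ℝ] V n} (hf : Function.Injective f) :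
      (Set.range f).ncard = 2 ^ n := by
    rw [← Set.image_univ, Set.ncard_image_of_injective _ hf, Set.ncard_univ,
      Nat.card_eq_fintype_card, Fintype.card_finset, Fintype.card_fin]
  have hsum := Set.ncard_union_add_ncard_inter (Set.range c) (Set.range (d (n := n)))
  rw [hinter, ← hunion, Set.ncard_singleton, hcard c_injective, hcard d_injective] at hsum
  lia

/-! ### Left multiplication by simple reflections -/

theorem reflect_e_sub_e {i j : Fin (n + 1)} (hij : i ≠ j) (x : V n) (k : Fin (n + 1)) :
    reflect (e i - e j) x k = x (Equiv.swap i j k) := by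
  have hα : (e i - e j : V n) ⬝ᵥ (e i - e j) = 2 := by
    norm_num [e, hij, hij.symm]
  have hx : x ⬝ᵥ (e i - e j : V n) = x i - x j := by simp [e, dotProduct_sub]
  rw [reflect, hα, hx, Equiv.swap_apply_def]
  split_ifs with hi hj
  · simp [e, hi, hij]
  · simp [e, hj, hij.symm]
  · simp [e, hi, hj]

theorem reflect_e_sub_e_signedPerm {i j : Fin (n + 1)} (hij : i ≠ j)
    (π : Equiv.Perm (Fin (n + 1))) (ε : Fin (n + 1) → ℤˣ) (x : V n) :
    reflect (e i - e j) (signedPerm π ε x) = signedPerm (Equiv.swap i j * π) ε x := by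
  ext k
  rw [reflect_e_sub_e hij]
  simp [signedPerm_apply, Equiv.Perm.mul_def]

theorem reflect_e_add_e_neg_e {i j : Fin (n + 1)} (hij : i ≠ j) :
    reflect (e i + e j) (-e j : V n) = e i := by
  have hα : (e i + e j : V n) ⬝ᵥ (e i + e j) = 2 := by
    norm_num [e, hij, hij.symm]
  have hx : (-e j : V n) ⬝ᵥ (e i + e j) = -1 := by simp [e, hij]
  rw [reflect, hα, hx]
  norm_num

theorem reflect_signedPerm (π : Equiv.Perm (Fin (n + 1))) (ε : Fin (n + 1) → ℤˣ) (α x : V n) :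
    reflect (signedPerm π ε α) (signedPerm π ε x) = signedPerm π ε (reflect α x) := by
  simp only [reflect, signedPerm_dotProduct_signedPerm, map_sub, map_smul]

theorem diagramAut_reflect (α x : V n) :
    diagramAut n (reflect α x) = reflect (diagramAut n α) (diagramAut n x) :=
  (reflect_signedPerm _ _ α x).symm

theorem diagramAut_e_castSucc_add_e_succ {a : Fin n} (ha : a.succ = Fin.last n) :
    diagramAut n (e a.castSucc + e a.succ) = e a.castSucc - e a.succ := by
  simpa [ha, signAt_self, sub_eq_add_neg] using
    diagramAut_e_add_units_smul_e (Fin.castSucc_ne_last a) a.succ 1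

theorem reflect_reflect {α : V n} (hα : α ≠ 0) (x : V n) : reflect α (reflect α x) = x := by
  have hα' : α ⬝ᵥ α ≠ 0 := dotProduct_self_eq_zero.not.mpr hα
  ext k
  simp only [reflect, sub_dotProduct, smul_dotProduct, smul_eq_mul, Pi.sub_apply, Pi.smul_apply]
  field_simp
  ring

theorem reflect_self {α : V n} (hα : α ≠ 0) : reflect α α = -α := by
  rw [reflect, mul_div_cancel_right₀ _ (dotProduct_self_eq_zero.not.mpr hα), two_smul,
    sub_add_cancel_left]

theorem ne_zero_of_mem_posRoots {x : V n} (hx : x ∈ posRoots n) : x ≠ 0 := by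
  obtain ⟨i, j, h, s, rfl⟩ := mem_posRoots_iff.mp hx
  rw [← one_smul ℤˣ (e i), Ne, add_eq_zero_iff_eq_neg, ← Units.neg_smul, units_smul_e_inj]
  exact fun heq => h.ne heq.2

/-- `v = s_α u` for some simple root `α`. -/
def Step (u v : V n ≃ₗ[ℝ] V n) : Prop := ∃ α ∈ simpleRoots n, ∀ x, v x = reflect α (u x)

theorem Step.symm (h : Step u v) : Step v u := by
  obtain ⟨α, hα, h⟩ := h
  refine ⟨α, hα, fun x => ?_⟩
  rw [h, reflect_reflect (ne_zero_of_mem_posRoots (simpleRoots_subset_posRoots hα))]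

theorem Step.ne (h : Step u v) : u ≠ v := by
  rintro rfl
  obtain ⟨α, hα, h⟩ := h
  have hα0 := ne_zero_of_mem_posRoots (simpleRoots_subset_posRoots hα)
  have hα' := h (u.symm α)
  rw [u.apply_symm_apply, reflect_self hα0, self_eq_neg] at hα'
  exact hα0 hα'

theorem Step.twist (h : Step u v) : Step (twist u) (twist v) := by
  obtain ⟨α, hα, h⟩ := h
  refine ⟨diagramAut n α, diagramAut_mem_simpleRoots hα, fun x => ?_⟩
  rw [twist_apply, twist_apply, h, diagramAut_reflect]

theorem Toggleable.step_c {I : Finset (Fin n)} {a : Fin n} (h : Toggleable I a) :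
    Step (c I) (c (symmDiff I {a})) := by
  refine ⟨_, Or.inl ⟨a, rfl⟩, fun x => ?_⟩
  rw [c_eq, c_eq, reflect_e_sub_e_signedPerm a.castSucc_lt_succ.ne, h.swap_mul_p]

theorem Toggleable.step_d {I : Finset (Fin n)} {a : Fin n} (h : Toggleable I a) :
    Step (d I) (d (symmDiff I {a})) := by
  rw [← twist_c, ← twist_c]
  exact h.step_c.twist

theorem exists_toggleable_of_eq_reflect_e_sub_e_c {I : Finset (Fin n)} {a : Fin n}
    (hv : IsRational v) (h : ∀ x, v x = reflect (e a.castSucc - e a.succ) (c I x)) :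
    Toggleable I a ∧ v = c (symmDiff I {a}) := by
  have hva : v = signedPerm (Equiv.swap a.castSucc a.succ * p I) (signAt (Fin.last n)) := by
    ext1 x
    rw [h, c_eq, reflect_e_sub_e_signedPerm a.castSucc_lt_succ.ne]
  have ha : Toggleable I a := isRaising_swap_mul_p_iff.mp (hva ▸ hv).isRaising
  exact ⟨ha, by rw [hva, c_eq, ha.swap_mul_p]⟩

theorem eq_empty_of_eq_reflect_e_add_e_c {I : Finset (Fin n)} {a : Fin n}
    (ha : a.succ = Fin.last n) (hv : IsRational v)
    (h : ∀ x, v x = reflect (e a.castSucc + e a.succ) (c I x)) : I = ∅ := by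
  by_contra hI
  have hlast : (p I).symm (Fin.last n) ≠ Fin.last n := p_symm_last_eq_last_iff.not.mpr hI
  have him : v (e ((p I).symm (Fin.last n))) = e a.castSucc := by
    rw [h, c_eq, signedPerm_e_eq_units_smul, signAt_of_ne hlast, Units.neg_smul, one_smul,
      Equiv.apply_symm_apply, ha, reflect_e_add_e_neg_e (Fin.castSucc_ne_last a)]
  exact Fin.castSucc_ne_last a (hv.eq_last_of_apply_e hlast him)

theorem exists_toggleable_of_step_c {I : Finset (Fin n)} (hv : IsRational v)
    (h : Step (c I) v) : ∃ a, Toggleable I a ∧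
      (v = c (symmDiff I {a}) ∨ I = ∅ ∧ v = d (symmDiff I {a})) := by
  obtain ⟨α, ⟨a, rfl⟩ | ⟨a, ha, rfl⟩, h⟩ := h
  · obtain ⟨haI, hva⟩ := exists_toggleable_of_eq_reflect_e_sub_e_c hv h
    exact ⟨a, haI, .inl hva⟩
  · obtain rfl := eq_empty_of_eq_reflect_e_add_e_c ha hv h
    have htwist (x : V n) :
        twist v x = reflect (e a.castSucc - e a.succ) (c (∅ : Finset (Fin n)) x) := by
      rw [twist_apply, h, diagramAut_reflect, diagramAut_e_castSucc_add_e_succ ha, ← twist_apply,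
        twist_c, d_empty, c_empty]
    obtain ⟨haI, hva⟩ := exists_toggleable_of_eq_reflect_e_sub_e_c hv.twist htwist
    exact ⟨a, haI, .inr ⟨rfl, twist_eq_c_iff.mp hva⟩⟩

/-! ### The graph -/

variable {x y : {u : V n ≃ₗ[ℝ] V n // IsRational u}} {I : Finset (Fin n)} {a : Fin n}

theorem rationalityGraph_adj : (rationalityGraph n).Adj x y ↔ Step x.1 y.1 := by
  rw [rationalityGraph, SimpleGraph.fromRel_adj]
  exact ⟨fun h => h.2.elim id Step.symm, fun h => ⟨fun hxy => h.ne (congrArg _ hxy), .inl h⟩⟩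

/-- The automorphism of `Γ(D_r)` induced by the diagram automorphism. -/
def twistIso (n : ℕ) : rationalityGraph n ≃g rationalityGraph n where
  toFun x := ⟨twist x.1, x.2.twist⟩
  invFun x := ⟨twist x.1, x.2.twist⟩
  left_inv x := Subtype.ext (twist_involutive x.1)
  right_inv x := Subtype.ext (twist_involutive x.1)
  map_rel_iff' {x y} := by
    rw [rationalityGraph_adj, rationalityGraph_adj]
    refine ⟨fun h => ?_, Step.twist⟩
    simpa only [Equiv.coe_fn_mk, twist_involutive _] using h.twist

theorem twistIso_apply_val (x : {u : V n ≃ₗ[ℝ] V n // IsRational u}) :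
    (twistIso n x).1 = twist x.1 := rfl

theorem adj_iff_of_eq_c (hx : x.1 = c I) : (rationalityGraph n).Adj x y ↔
    ∃ a, Toggleable I a ∧ (y.1 = c (symmDiff I {a}) ∨ I = ∅ ∧ y.1 = d (symmDiff I {a})) := by
  rw [rationalityGraph_adj, hx]
  refine ⟨exists_toggleable_of_step_c y.2, ?_⟩
  rintro ⟨a, ha, hy | ⟨rfl, hy⟩⟩ <;> rw [hy]
  · exact ha.step_c
  · rw [c_empty, ← d_empty]
    exact ha.step_d

theorem adj_iff_of_eq_d (hx : x.1 = d I) : (rationalityGraph n).Adj x y ↔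
    ∃ a, Toggleable I a ∧ (y.1 = d (symmDiff I {a}) ∨ I = ∅ ∧ y.1 = c (symmDiff I {a})) := by
  rw [← (twistIso n).map_adj_iff, adj_iff_of_eq_c (twist_eq_c_iff.mpr hx)]
  simp only [twistIso_apply_val, twist_eq_c_iff, twist_eq_d_iff]

theorem symmDiff_singleton_inj {a b : Fin n} : symmDiff I {a} = symmDiff I {b} ↔ a = b :=
  (symmDiff_right_injective I).eq_iff.trans Finset.singleton_inj

theorem adj_iff_toggleable_of_eq_c (hx : x.1 = c I) (hy : y.1 = c (symmDiff I {a})) :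
    (rationalityGraph n).Adj x y ↔ Toggleable I a := by
  rw [adj_iff_of_eq_c hx, hy]
  refine ⟨?_, fun ha => ⟨a, ha, .inl rfl⟩⟩
  rintro ⟨b, hb, h | ⟨rfl, h⟩⟩
  · rwa [symmDiff_singleton_inj.mp (c_injective h)]
  · simpa using (c_eq_d_iff.mp h).1

theorem adj_iff_toggleable_of_eq_d (hx : x.1 = d I) (hy : y.1 = d (symmDiff I {a})) :
    (rationalityGraph n).Adj x y ↔ Toggleable I a := by
  rw [← (twistIso n).map_adj_iff]
  exact adj_iff_toggleable_of_eq_c (twist_eq_c_iff.mpr hx) (twist_eq_c_iff.mpr hy)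

theorem exists_toggleable_of_adj (hn : Even n) (h : (rationalityGraph n).Adj x y) :
    ∃ (I : Finset (Fin n)) (a : Fin n), Toggleable I a ∧
      ((x.1 = c I ∧ y.1 = c (symmDiff I {a})) ∨ (x.1 = d I ∧ y.1 = d (symmDiff I {a}))) := by
  obtain ⟨I, hx | hx⟩ := x.2.exists_eq hn
  · obtain ⟨a, ha, hy | ⟨rfl, hy⟩⟩ := (adj_iff_of_eq_c hx).mp h
    · exact ⟨I, a, ha, .inl ⟨hx, hy⟩⟩
    · exact ⟨∅, a, ha, .inr ⟨hx.trans (c_eq_d_iff.mpr ⟨rfl, rfl⟩), hy⟩⟩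
  · obtain ⟨a, ha, hy | ⟨rfl, hy⟩⟩ := (adj_iff_of_eq_d hx).mp h
    · exact ⟨I, a, ha, .inr ⟨hx, hy⟩⟩
    · exact ⟨∅, a, ha, .inl ⟨hx.trans (c_eq_d_iff.mpr ⟨rfl, rfl⟩).symm, hy⟩⟩

/-! ### Vertices of valency one -/

theorem forall_toggleable_eq_iff {z m : Fin n} (hz : (z : ℕ) = 0) (hm : m.succ = Fin.last n) :
    (∀ a, Toggleable I a → a = m) ↔ I ⊆ {z} := by
  have hmn : (m : ℕ) + 1 = n := congrArg Fin.val hm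
  constructor
  · intro h b hb
    by_contra hbz
    have hb0 : (b : ℕ) ≠ 0 := fun hb0 =>
      hbz (Finset.mem_singleton.mpr (Fin.ext (hb0.trans hz.symm)))
    have heq := h ⟨b - 1, by lia⟩ (.inr ⟨b, hb, by dsimp only; lia⟩)
    rw [Fin.ext_iff] at heq
    dsimp only at heq
    lia
  · rintro h a (ha | ⟨b, hb, hba⟩)
    · exact Fin.succ_injective _ (ha.trans hm.symm)
    · rw [Finset.mem_singleton.mp (h hb)] at hba
      lia

theorem forall_adj_eq_iff (hn : Even n) {m : Fin n} (hm : m.succ = Fin.last n) (hx : x.1 = c I) :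
    (∀ y, (rationalityGraph n).Adj x y → y.1 = c (symmDiff I {m})) ↔
      I ≠ ∅ ∧ ∀ a, Toggleable I a → a = m := by
  constructor
  · refine fun h => ⟨?_, fun a ha => ?_⟩
    · rintro rfl
      have hadj : (rationalityGraph n).Adj x ⟨d (symmDiff ∅ {m}), isRational_d hn _⟩ :=
        (adj_iff_of_eq_c hx).mpr ⟨m, .inl hm, .inr ⟨rfl, rfl⟩⟩
      have hdc : d (symmDiff ∅ {m}) = c (symmDiff ∅ {m}) := h _ hadj
      simpa using (c_eq_d_iff.mp hdc.symm).1
    · have hadj : (rationalityGraph n).Adj x ⟨c (symmDiff I {a}), isRational_c hn _⟩ :=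
        (adj_iff_toggleable_of_eq_c hx rfl).mpr ha
      exact symmDiff_singleton_inj.mp (c_injective (h _ hadj))
  · rintro ⟨hI, h⟩ y hxy
    obtain ⟨a, ha, hy | ⟨rfl, -⟩⟩ := (adj_iff_of_eq_c hx).mp hxy
    exacts [h a ha ▸ hy, absurd rfl hI]

theorem ncard_neighborSet_eq_one_iff_of_eq_c (hn : Even n) {z : Fin n} (hz : (z : ℕ) = 0)
    (hx : x.1 = c I) : ((rationalityGraph n).neighborSet x).ncard = 1 ↔ I = {z} := by
  obtain ⟨m, hm⟩ : ∃ m : Fin n, m.succ = Fin.last n :=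
    Fin.exists_succ_eq.mpr ((Fin.zero_le _).trans_lt (Fin.castSucc_lt_last z)).ne'
  have hxm : (rationalityGraph n).Adj x ⟨c (symmDiff I {m}), isRational_c hn _⟩ :=
    (adj_iff_toggleable_of_eq_c hx rfl).mpr (.inl hm)
  have huniq : ((rationalityGraph n).neighborSet x).ncard = 1 ↔
      ∀ y, (rationalityGraph n).Adj x y → y.1 = c (symmDiff I {m}) := by
    rw [Set.ncard_eq_one]
    constructor
    · rintro ⟨t, ht⟩ y hxy
      have heq {w} (hw : (rationalityGraph n).Adj x w) : w = t := (Set.ext_iff.mp ht w).mp hw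
      rw [heq hxy, ← heq hxm]
    · exact fun h => ⟨_, Set.eq_singleton_iff_unique_mem.mpr
        ⟨hxm, fun y hxy => Subtype.ext (h y hxy)⟩⟩
  rw [huniq, forall_adj_eq_iff hn hm hx, forall_toggleable_eq_iff hz hm,
    Finset.subset_singleton_iff]
  refine ⟨fun h => h.2.resolve_left h.1, ?_⟩
  rintro rfl
  exact ⟨Finset.singleton_ne_empty z, .inr rfl⟩

theorem ncard_neighborSet_twistIso (x : {u : V n ≃ₗ[ℝ] V n // IsRational u}) :
    ((rationalityGraph n).neighborSet (twistIso n x)).ncard =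
      ((rationalityGraph n).neighborSet x).ncard :=
  (Set.ncard_congr' ((twistIso n).mapNeighborSet x)).symm

theorem ncard_neighborSet_eq_one_iff (hn : Even n) {z : Fin n} (hz : (z : ℕ) = 0) :
    ((rationalityGraph n).neighborSet x).ncard = 1 ↔ x.1 = c {z} ∨ x.1 = d {z} := by
  obtain ⟨I, hx | hx⟩ := x.2.exists_eq hn
  · rw [ncard_neighborSet_eq_one_iff_of_eq_c hn hz hx, hx, c_injective.eq_iff, c_eq_d_iff]
    simp
  · rw [← ncard_neighborSet_twistIso,
      ncard_neighborSet_eq_one_iff_of_eq_c hn hz (twist_eq_c_iff.mpr hx), hx, d_injective.eq_iff,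
      eq_comm (a := d I), c_eq_d_iff]
    simp

end TypeD

theorem theorem1p1 (n : ℕ) (hr : 5 ≤ n + 1) (hodd : Odd (n + 1)) :
    {u : TypeD.V n ≃ₗ[ℝ] TypeD.V n | TypeD.IsRational u} =
      {TypeD.w0 n} ∪ {u | ∃ I : Finset (Fin n), I.Nonempty ∧ (u = TypeD.c I ∨ u = TypeD.d I)} ∧
    {u : TypeD.V n ≃ₗ[ℝ] TypeD.V n | TypeD.IsRational u}.ncard = 1 + 2 * (2 ^ n - 1) ∧
    {u : TypeD.V n ≃ₗ[ℝ] TypeD.V n | TypeD.IsRational u}.ncard = 2 ^ (n + 1) - 1 ∧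
    ∃ (hc : ∀ I : Finset (Fin n), TypeD.IsRational (TypeD.c I))
      (hd : ∀ I : Finset (Fin n), TypeD.IsRational (TypeD.d I)),
      -- toggling `a ≤ r - 2`
      (∀ (I : Finset (Fin n)) (a b : Fin n), (b : ℕ) = a + 1 →
        ((TypeD.rationalityGraph n).Adj ⟨TypeD.c I, hc I⟩
          ⟨TypeD.c (symmDiff I {a}), hc (symmDiff I {a})⟩ ↔ b ∈ I)) ∧
      (∀ (I : Finset (Fin n)) (a b : Fin n), (b : ℕ) = a + 1 →
        ((TypeD.rationalityGraph n).Adj ⟨TypeD.d I, hd I⟩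
          ⟨TypeD.d (symmDiff I {a}), hd (symmDiff I {a})⟩ ↔ b ∈ I)) ∧
      -- toggling `m = r - 1`
      (∀ (I : Finset (Fin n)) (m : Fin n), m.succ = Fin.last n →
        (TypeD.rationalityGraph n).Adj ⟨TypeD.c I, hc I⟩
          ⟨TypeD.c (symmDiff I {m}), hc (symmDiff I {m})⟩ ∧
        (TypeD.rationalityGraph n).Adj ⟨TypeD.d I, hd I⟩
          ⟨TypeD.d (symmDiff I {m}), hd (symmDiff I {m})⟩) ∧
      -- no other edges
      (∀ u v, (TypeD.rationalityGraph n).Adj u v →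
        ∃ (I : Finset (Fin n)) (a : Fin n),
          (a.succ = Fin.last n ∨ ∃ b ∈ I, (b : ℕ) = a + 1) ∧
          ((u.1 = TypeD.c I ∧ v.1 = TypeD.c (symmDiff I {a})) ∨
            (u.1 = TypeD.d I ∧ v.1 = TypeD.d (symmDiff I {a})))) ∧
      -- the vertices of valency one
      (∀ u, ((TypeD.rationalityGraph n).neighborSet u).ncard = 1 ↔
        u.1 = TypeD.c {⟨0, by omega⟩} ∨ u.1 = TypeD.d {⟨0, by omega⟩}) := by
  have hn : Even n := by simpa [Nat.odd_add_one] using hodd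
  have hcard := TypeD.ncard_setOf_isRational hn
  refine ⟨TypeD.setOf_isRational hn, ?_, hcard, TypeD.isRational_c hn, TypeD.isRational_d hn,
    ?_, ?_, ?_, ?_, ?_⟩
  · have hpos := Nat.one_le_two_pow (n := n)
    rw [hcard, pow_succ]
    lia
  · exact fun I a b hab =>
      (TypeD.adj_iff_toggleable_of_eq_c rfl rfl).trans (TypeD.toggleable_iff_mem hab)
  · exact fun I a b hab =>
      (TypeD.adj_iff_toggleable_of_eq_d rfl rfl).trans (TypeD.toggleable_iff_mem hab)
  · exact fun I m hm => ⟨(TypeD.adj_iff_toggleable_of_eq_c rfl rfl).mpr (.inl hm),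
      (TypeD.adj_iff_toggleable_of_eq_d rfl rfl).mpr (.inl hm)⟩
  · exact fun _ _ => TypeD.exists_toggleable_of_adj hn
  · exact fun _ => TypeD.ncard_neighborSet_eq_one_iff hn rfl
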